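/- \textbf{Setting.} Let $\mathcal S=\{S_1,\dots,S_N\}$ be an iterated function system (IFS) of contracting similitudes of $\mathbb R^d$ (that is, $|S_j(x)-S_j(y)|=c_j|x-y|$ with $0<c_j<1$), with invariant set $K$, i.e. $K$ is the non-empty compact set with $K=\bigcup_{j=1}^N S_j(K)$. Suppose that $\mathcal S$ satisfies the open set condition (OSC): there is a non-empty open set $U$ such that the sets $S_1(U),\dots,S_N(U)$ are pairwise disjoint and contained in $U$. Let $A=\{a_1,\dots,a_m\}\subset K$ ($m\ge 1$, the $a_i$ distinct) be a finite skeleton of $\mathcal S$: $A\subset\bigcup_{j}S_j(A)$, and the graph on $\{1,\dots,N\}$ in which $i\neq j$ are joined iff $S_i(A)\cap S_j(A)\ne\emptyset$ is connected. Put $a_{m+1}=a_1$. Let $V=\{v_1,\dots,v_m,v_1^{-1},\dots,v_m^{-1}\}$ be a set of $2m$ distinct abstract directed edges, where $v_j$ goes from $a_j$ to $a_{j+1}$ and $v_j^{-1}$ from $a_{j+1}$ to $a_j$; put $(v_j^{-1})^{-1}=v_j^{1}=v_j$ and $|v_j|=|v_j^{-1}|=v_j$. For $v\in V$ going from $x$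 to $y$, let $S_i(v)$ be an abstract edge from $S_i(x)$ to $S_i(y)$; different pairs $(i,v)$ give different edges. For an orientation vector $\beta\in\{1,-1\}^N$ let $G(\mathcal S,A,\beta)$ be the directed graph with the edges $S_i(v_j^{\beta_i})$, $1\le i\le N$, $1\le j\le m$. Let $P$ be a unicursal path of $G(\mathcal S,A,\beta)$, i.e. a directed path that passes every edge exactly once. Let $P=P_1+\cdots+P_m$ be a consistent partition of it, i.e. $P$ is the concatenation of the paths $P_1,\dots,P_m$, which have pairwise no common edge, and $P_j$ is a path from $a_j$ to $a_{j+1}$ for every $j$. Write $$P_j=S_{j,1}(v_{j,1})\cdots S_{j,\ell_j}(v_{j,\ell_j}),\qquad S_{j,k}\in\mathcal S,\ v_{j,k}\in V .$$ The partition is called primitive if the substitution $\tau^*: v_j\mapsto |v_{j,1}|\cdots|v_{j,\ell_j}|$ over the alphabet $\{v_1,\dots,v_m\}$ is primitive: there is $n\ge1$ such that every letter appears in $(\tau^*)^n(v)$ for every letter $v$. The graph-directed IFS (GIFS) induced by the partition has state set $V$. For $1\le k\le \ell_j$, the $k$-th edge leaving the state $v_j$ leads to the state $v_{j,k}$ and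 carries the similitude $S_{j,k}$; the $k$-th edge leaving $v_j^{-1}$ leads to $v_{j,\ell_j-k+1}^{-1}$ and carries $S_{j,\ell_j-k+1}$. Its invariant sets $\{E_v\}_{v\in V}$ are the non-empty compact sets such that, for all $j$, $$E_{v_j}=\bigcup_{k=1}^{\ell_j}S_{j,k}(E_{v_{j,k}}),\qquad E_{v_j^{-1}}=\bigcup_{k=1}^{\ell_j}S_{j,k}(E_{v_{j,k}^{-1}}).$$ It satisfies the OSC if there are non-empty open sets $\{U_v\}_{v\in V}$ such that, for every state $u$, the sets $g_e(U_{t(e)})$, where $e$ runs over the edges leaving $u$, with similitude $g_e$ and terminal state $t(e)$, are pairwise disjoint and contained in $U_u$. \textbf{Theorem.} If the partition $P=P_1+\cdots+P_m$ is consistent and primitive, then the GIFS induced by it satisfies the OSC, and $0<\mathcal H^s(E_v)<\infty$ for all $v\in V$, where $s=\dim_H K$. -/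

import Mathlib

namespace SpaceFilling

/-- A contracting similitude of `ℝ^d`, with contraction ratio in `(0, 1)`. -/
structure ContractingSimilitude (d : ℕ) where
  toFun : EuclideanSpace ℝ (Fin d) → EuclideanSpace ℝ (Fin d)
  ratio : ℝ
  ratio_pos : 0 < ratio
  ratio_lt_one : ratio < 1
  dist_map : ∀ x y, dist (toFun x) (toFun y) = ratio * dist x y

instance (d : ℕ) : CoeFun (ContractingSimilitude d)
    (fun _ => EuclideanSpace ℝ (Fin d) → EuclideanSpace ℝ (Fin d)) :=
  ⟨ContractingSimilitude.toFun⟩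

/-! ### Iterated function systems and skeletons -/

/-- An iterated function system `S_1, …, S_N` on `ℝ^d`. -/
abbrev IFS (d N : ℕ) : Type := Fin N → ContractingSimilitude d

namespace IFS

variable {d N : ℕ}

/-- `K` is the invariant set of the IFS. -/
def IsInvariantSet (S : IFS d N) (K : Set (EuclideanSpace ℝ (Fin d))) : Prop :=
  K.Nonempty ∧ IsCompact K ∧ K = ⋃ j, S j '' K

/-- The open set condition for an IFS. -/
def OpenSetCondition (S : IFS d N) : Prop :=
  ∃ U : Set (EuclideanSpace ℝ (Fin d)), IsOpen U ∧ U.Nonempty ∧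
    (⋃ i, S i '' U) ⊆ U ∧ ∀ i j, i ≠ j → Disjoint (S i '' U) (S j '' U)

/-- The Hata graph `H(F)`: the vertices are the maps of the IFS (represented by their indices),
and two different vertices `i`, `j` are joined iff `S_i(F)` meets `S_j(F)`. -/
def hataGraph (S : IFS d N) (F : Set (EuclideanSpace ℝ (Fin d))) : SimpleGraph (Fin N) where
  Adj i j := i ≠ j ∧ (S i '' F ∩ S j '' F).Nonempty
  symm := ⟨fun _ _ h => ⟨h.1.symm, by rw [Set.inter_comm]; exact h.2⟩⟩
  loopless := ⟨fun _ h => h.1 rfl⟩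

/-- `A` is a skeleton of the IFS `S` with invariant set `K`. -/
def IsSkeleton (S : IFS d N) (K A : Set (EuclideanSpace ℝ (Fin d))) : Prop :=
  A ⊆ K ∧ (S.hataGraph A).Connected ∧ A ⊆ ⋃ j, S j '' A

end IFS

/-! ### Graph-directed iterated function systems -/

/-- A graph-directed IFS on `ℝ^d` with state set `V`: a directed multigraph on `V` with finitely
many edges, and a contracting similitude for every edge. -/
structure GIFS (d : ℕ) (V : Type*) where
  Edge : Type
  edge_finite : Finite Edge
  src : Edge → V
  tgt : Edge → V
  map : Edge → ContractingSimilitude d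

/-- An ordered GIFS: the edges carry a (strict) partial order that is linear on the set of edges
leaving any given state, while edges leaving different states are not comparable. -/
structure OrderedGIFS (d : ℕ) (V : Type*) extends GIFS d V where
  prec : Edge → Edge → Prop
  prec_irrefl : ∀ e, ¬ prec e e
  prec_trans : ∀ e f g, prec e f → prec f g → prec e g
  prec_total : ∀ e f, src e = src f → e ≠ f → prec e f ∨ prec f e
  prec_src : ∀ e f, prec e f → src e = src f

namespace GIFS

variable {d : ℕ} {V : Type*}

/-- `E` is the family of invariant sets of the GIFS: nonempty compact sets such that, for every
state `u`, `E_u` is the union of the `g_e(E_{t(e)})` over all edges `e` leaving `u`. -/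
def IsInvariantFamily (G : GIFS d V) (E : V → Set (EuclideanSpace ℝ (Fin d))) : Prop :=
  (∀ u, (E u).Nonempty ∧ IsCompact (E u)) ∧
    ∀ u, E u = ⋃ (e : G.Edge) (_ : G.src e = u), G.map e '' E (G.tgt e)

/-- The open set condition for a GIFS: there are nonempty open sets `U_v` such that, for every
state `u`, the sets `g_e(U_{t(e)})`, `e` an edge leaving `u`, are pairwise disjoint subsets of
`U_u`. -/
def OpenSetCondition (G : GIFS d V) : Prop :=
  ∃ U : V → Set (EuclideanSpace ℝ (Fin d)),
    (∀ v, IsOpen (U v) ∧ (U v).Nonempty) ∧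
    (∀ e, G.map e '' U (G.tgt e) ⊆ U (G.src e)) ∧
    ∀ e f, e ≠ f → G.src e = G.src f →
      Disjoint (G.map e '' U (G.tgt e)) (G.map f '' U (G.tgt f))

end GIFS

/-! ### The loop through the skeleton and its affine copies -/

/-- The `2m` abstract edges `v_i` (coded by `(i, 1)`) and `v_i⁻¹` (coded by `(i, -1)`). -/
abbrev OrientedEdge (m : ℕ) : Type := Fin m × ℤˣ

namespace OrientedEdge

variable {d m : ℕ}

/-- `v_i ↦ v_i⁻¹` and `v_i⁻¹ ↦ v_i`. -/
def rev (v : OrientedEdge m) : OrientedEdge m := (v.1, -v.2)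

/-- The initial point: `a_i` for `v_i`, and `a_{i+1}` for `v_i⁻¹`. Addition in `Fin m` is cyclic,
so that the successor of the last index is the first one. -/
def init [NeZero m] (a : Fin m → EuclideanSpace ℝ (Fin d)) (v : OrientedEdge m) :
    EuclideanSpace ℝ (Fin d) :=
  if v.2 = 1 then a v.1 else a (v.1 + 1)

/-- The terminal point: `a_{i+1}` for `v_i`, and `a_i` for `v_i⁻¹`. -/
def term [NeZero m] (a : Fin m → EuclideanSpace ℝ (Fin d)) (v : OrientedEdge m) :
    EuclideanSpace ℝ (Fin d) :=
  if v.2 = 1 then a (v.1 + 1) else a v.1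

end OrientedEdge

/-- The abstract edges `S_i(v)` of the induced graph, coded by `(i, v)`; edges with different
codes are different, even if they coincide as oriented segments. -/
abbrev CopyEdge (N m : ℕ) : Type := Fin N × OrientedEdge m

section Paths

variable {d N m : ℕ} [NeZero m]

/-- The initial point of `S_i(v)`. -/
def CopyEdge.init (S : IFS d N) (a : Fin m → EuclideanSpace ℝ (Fin d)) (e : CopyEdge N m) :
    EuclideanSpace ℝ (Fin d) :=
  S e.1 (OrientedEdge.init a e.2)

/-- The terminal point of `S_i(v)`. -/
def CopyEdge.term (S : IFS d N) (a : Fin m → EuclideanSpace ℝ (Fin d)) (e : CopyEdge N m) :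
    EuclideanSpace ℝ (Fin d) :=
  S e.1 (OrientedEdge.term a e.2)

/-- The edge set of `G(S, A, β) = ⋃_j S_j(Λ_0^{β_j})`: the edges `S_j(v_i^{β_j})`. -/
def orientedGraph (β : Fin N → ℤˣ) : Set (CopyEdge N m) :=
  {e | e.2.2 = β e.1}

/-- The list `P` of edges is a path from the point `x` to the point `y`. -/
def IsPathFromTo (S : IFS d N) (a : Fin m → EuclideanSpace ℝ (Fin d)) :
    EuclideanSpace ℝ (Fin d) → List (CopyEdge N m) → EuclideanSpace ℝ (Fin d) → Prop
  | x, [], y => x = y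
  | x, e :: P, y => CopyEdge.init S a e = x ∧ IsPathFromTo S a (CopyEdge.term S a e) P y

/-- `P` is a unicursal path of `G(S, A, β)`: a path that passes every edge exactly once. -/
def IsUnicursalPath (S : IFS d N) (a : Fin m → EuclideanSpace ℝ (Fin d)) (β : Fin N → ℤˣ)
    (P : List (CopyEdge N m)) : Prop :=
  (∃ x y, IsPathFromTo S a x P y) ∧ P.Nodup ∧ ∀ e, e ∈ P ↔ e ∈ orientedGraph β

/-- `P = P_1 + ⋯ + P_m` is a consistent partition of the unicursal path `P` of `G(S, A, β)`: the
paths `P_i` have no edge in common, and `P_i` leads from `a_i` to `a_{i+1}`. -/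
structure IsConsistentPartition (S : IFS d N) (a : Fin m → EuclideanSpace ℝ (Fin d))
    (β : Fin N → ℤˣ) (P : List (CopyEdge N m)) (Q : Fin m → List (CopyEdge N m)) : Prop where
  unicursal : IsUnicursalPath S a β P
  eq_concat : P = (List.ofFn Q).flatten
  disjoint : ∀ i j, i ≠ j → (Q i).Disjoint (Q j)
  consistent : ∀ i, IsPathFromTo S a (a i) (Q i) (a (i + 1))

end Paths

/-! ### Substitutions and the induced GIFS -/

/-- A substitution `σ` over an alphabet is primitive if for some `n ≥ 1` all letters appear in
`σ^n(v)`, for every letter `v`. -/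
def IsPrimitiveSubstitution {α : Type*} (σ : α → List α) : Prop :=
  ∃ n : ℕ, 1 ≤ n ∧ ∀ u v : α, u ∈ (fun w : List α => w.flatMap σ)^[n] [v]

section Induced

variable {d N m : ℕ}

/-- The reverse path: the edges `S_i(v)` are replaced by `S_i(v⁻¹)`, in the reverse order. -/
def reversePath (P : List (CopyEdge N m)) : List (CopyEdge N m) :=
  (P.map fun e => (e.1, e.2.rev)).reverse

/-- The fine substitution rule `τ : v_j ↦ P_j, v_j⁻¹ ↦ P_j⁻¹`. -/
def fineSubstitution (Q : Fin m → List (CopyEdge N m)) (v : OrientedEdge m) :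
    List (CopyEdge N m) :=
  if v.2 = 1 then Q v.1 else reversePath (Q v.1)

/-- The coarse substitution `τ* : v_j ↦ |v_{j,1}| ⋯ |v_{j,ℓ_j}|` over `{v_1, …, v_m}`. -/
def coarseSubstitution (Q : Fin m → List (CopyEdge N m)) (j : Fin m) : List (Fin m) :=
  (Q j).map fun e => e.2.1

/-- The partition `P_1 + ⋯ + P_m` is primitive. -/
def IsPrimitivePartition (Q : Fin m → List (CopyEdge N m)) : Prop :=
  IsPrimitiveSubstitution (coarseSubstitution Q)

/-- The (ordered) GIFS induced by the partition `P_1 + ⋯ + P_m`. The states are the `v_j` and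
`v_j⁻¹`. If the `k`-th edge of the path `τ(u)` is `S_i(v)`, then the `k`-th edge leaving the
state `u` leads to the state `v` and its similitude is `S_i`. -/
def inducedGIFS (S : IFS d N) (Q : Fin m → List (CopyEdge N m)) :
    OrderedGIFS d (OrientedEdge m) where
  Edge := Σ u : OrientedEdge m, Fin (fineSubstitution Q u).length
  edge_finite := inferInstance
  src b := b.1
  tgt b := ((fineSubstitution Q b.1).get b.2).2
  map b := S ((fineSubstitution Q b.1).get b.2).1
  prec b c := b.1 = c.1 ∧ b.2.val < c.2.val
  prec_irrefl _ h := lt_irrefl _ h.2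
  prec_trans b c e h h' := ⟨h.1.trans h'.1, h.2.trans h'.2⟩
  prec_total := by
    rintro ⟨u, k⟩ ⟨v, l⟩ (rfl : u = v) hne
    rcases lt_trichotomy k.val l.val with h | h | h
    · exact Or.inl ⟨rfl, h⟩
    · exact absurd (by rw [Fin.ext h]) hne
    · exact Or.inr ⟨rfl, h⟩
  prec_src b c h := h.1

end Induced

end SpaceFilling

open SpaceFilling
open scoped NNReal MeasureTheory

open Set Metric Filter Topology MeasureTheory

/-! The IFS and the induced GIFS use the same similitudes, so separation and measure pass from `K`
to the `E_v`.

Separation. Under the OSC of the IFS, a bounded number of cylinders of scale `r` come within `r` of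
any given point (`IFS.OpenSetCondition.exists_card_le`). A consistent partition and its reversed
paths contain every pair `(i, v)` exactly once. So an edge of the GIFS is determined by its map and
its target, and a path by its index word and its end state (`IsConsistentPartition.path_injective`).
The cylinder bound therefore holds for the GIFS too, with `2m` times the constant. Such a bound
yields the OSC by a Bandt–Schief argument (`GIFS.IsInvariantFamily.openSetCondition`): if a path has
the maximal number of neighbors, prepending an edge creates no new ones, so small balls around its
base point have disjoint images. This needs states joined by an edge to reach each other.
Primitivity gives reachability only up to orientation, but the symmetry `v ↦ v⁻¹` repairs this
(`IsPrimitivePartition.reaches_symm`).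

Measure. Let `s` solve `∑ c_i ^ s = 1`. Covering by cylinders gives `μH[s] K < ⊤`, a mass
distribution gives `0 < μH[s] K`, and hence `s = dimH K`. Since `E_v ⊆ K ⊆ ⋃ E_u`, all `E_v` have
finite measure and at least one has positive measure. Positivity spreads because `E_u` contains a
similar copy of each `E_v` that `u` reaches, and `E_v`, `E_{v⁻¹}` coincide. -/

namespace SpaceFilling

/-! ### Compositions along words, and cut sets -/

section Words

variable {d : ℕ} {ι κ : Type*}

/-- The composition `g_{i_1} ∘ ⋯ ∘ g_{i_n}` along a word `i_1 ⋯ i_n`. -/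
def wordMap (g : ι → ContractingSimilitude d) : List ι → EuclideanSpace ℝ (Fin d) → EuclideanSpace ℝ (Fin d)
  | [], x => x
  | i :: w, x => g i (wordMap g w x)

/-- The contraction ratio of `wordMap g w`. -/
def wordRatio (g : ι → ContractingSimilitude d) : List ι → ℝ
  | [] => 1
  | i :: w => (g i).ratio * wordRatio g w

variable (g : ι → ContractingSimilitude d)

theorem wordRatio_pos (w : List ι) : 0 < wordRatio g w := by
  induction w with
  | nil => exact one_pos
  | cons i w ih => exact mul_pos (g i).ratio_pos ih

theorem wordRatio_le_one (w : List ι) : wordRatio g w ≤ 1 := by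
  induction w with
  | nil => exact le_rfl
  | cons i w ih => exact mul_le_one₀ (g i).ratio_lt_one.le (wordRatio_pos g w).le ih

theorem dist_wordMap (w : List ι) (x y : EuclideanSpace ℝ (Fin d)) :
    dist (wordMap g w x) (wordMap g w y) = wordRatio g w * dist x y := by
  induction w with
  | nil => simp [wordMap, wordRatio]
  | cons i w ih =>
    simp only [wordMap, wordRatio]
    rw [(g i).dist_map, ih, mul_assoc]

theorem wordMap_append (u w : List ι) (x : EuclideanSpace ℝ (Fin d)) :
    wordMap g (u ++ w) x = wordMap g u (wordMap g w x) := by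
  induction u with
  | nil => rfl
  | cons i u ih => simp [wordMap, ih]

theorem wordMap_map (g : κ → ContractingSimilitude d) (f : ι → κ) (w : List ι) :
    wordMap g (w.map f) = wordMap (g ∘ f) w := by
  funext x
  induction w with
  | nil => rfl
  | cons i w ih => simp [wordMap, ih]

theorem wordRatio_map (g : κ → ContractingSimilitude d) (f : ι → κ) (w : List ι) :
    wordRatio g (w.map f) = wordRatio (g ∘ f) w := by
  induction w with
  | nil => rfl
  | cons i w ih => simp [wordRatio, ih]

theorem wordRatio_eq_prod (w : List ι) :
    wordRatio g w = (w.map fun i => (g i).ratio).prod := by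
  induction w with
  | nil => rfl
  | cons i w ih => simp [wordRatio, ih]

/-- The words of the cut set at scale `r`: the shortest words of ratio at most `r`. -/
def IsCutWord (r : ℝ) (w : List ι) : Prop :=
  wordRatio g w ≤ r ∧ ∀ p, p <+: w → wordRatio g p ≤ r → p = w

theorem exists_isCutWord_prefix {r : ℝ} (w : List ι) (hw : wordRatio g w ≤ r) :
    ∃ p, p <+: w ∧ IsCutWord g r p := by
  induction hn : w.length using Nat.strong_induction_on generalizing w with
  | _ n ih =>
    subst hn
    by_cases h : ∀ p, p <+: w → wordRatio g p ≤ r → p = w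
    · exact ⟨w, List.prefix_rfl, hw, h⟩
    · push Not at h
      obtain ⟨p, hp, hr, hne⟩ := h
      have hlt : p.length < w.length :=
        lt_of_le_of_ne hp.length_le fun h => hne (hp.eq_of_length h)
      obtain ⟨q, hq, hq'⟩ := ih _ hlt p hr rfl
      exact ⟨q, hq.trans hp, hq'⟩

theorem IsCutWord.eq_of_prefix {r : ℝ} {u w : List ι} (hu : IsCutWord g r u)
    (hw : IsCutWord g r w) (h : u <+: w) : u = w :=
  hw.2 u h hu.1

theorem IsCutWord.cons {r : ℝ} {w : List ι} (hw : IsCutWord g r w) (hr : r ≤ 1) (i : ι) :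
    IsCutWord g ((g i).ratio * r) (i :: w) := by
  refine ⟨mul_le_mul_of_nonneg_left hw.1 (g i).ratio_pos.le, ?_⟩
  rintro (_ | ⟨j, p⟩) hp hpr
  -- The empty prefix has ratio `1`, which exceeds `(g i).ratio * r` because `r ≤ 1`.
  · exfalso
    have h1 : (1 : ℝ) ≤ (g i).ratio * r := hpr
    have h2 : (g i).ratio * r ≤ (g i).ratio := mul_le_of_le_one_right (g i).ratio_pos.le hr
    linarith [(g i).ratio_lt_one]
  · obtain ⟨rfl, hp'⟩ := List.cons_prefix_cons.1 hp
    rw [hw.2 p hp' (le_of_mul_le_mul_left hpr (g j).ratio_pos)]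

theorem IsCutWord.of_map {g : κ → ContractingSimilitude d} {f : ι → κ} {r : ℝ} {w : List ι}
    (hw : IsCutWord (g ∘ f) r w) : IsCutWord g r (w.map f) := by
  refine ⟨by rw [wordRatio_map]; exact hw.1, fun p hp hpr => ?_⟩
  obtain ⟨q, hq, rfl⟩ := List.prefix_map_iff.1 hp
  rw [wordRatio_map] at hpr
  rw [hw.2 q hq hpr]

theorem wordRatio_concat (w : List ι) (i : ι) :
    wordRatio g (w ++ [i]) = wordRatio g w * (g i).ratio := by
  simp [wordRatio_eq_prod]

/-- Dropping the last letter of a cut word gives a ratio above `r`, so the cut word itself loses at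
most one factor `c`. -/
theorem IsCutWord.mul_le {r : ℝ} {w : List ι} (hw : IsCutWord g r w) (hr : r ≤ 1)
    {c : ℝ} (hc : ∀ i, c ≤ (g i).ratio) (hc0 : 0 ≤ c) (hc1 : c ≤ 1) : c * r ≤ wordRatio g w := by
  rcases List.eq_nil_or_concat w with rfl | ⟨p, i, rfl⟩
  · have : wordRatio g [] = 1 := rfl
    rw [this]
    nlinarith
  · rw [List.concat_eq_append] at hw ⊢
    have h : r < wordRatio g p := by
      by_contra! h
      have := hw.2 p (List.prefix_append _ _) h
      simp at this
    rw [wordRatio_concat, mul_comm]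
    exact mul_le_mul h.le (hc i) hc0 (wordRatio_pos g p).le

end Words

/-! ### Bounded number of cylinders near a point -/

section Packing

variable {d N : ℕ}

/-- At every scale `r`, the number of `δ * r`-separated points in a ball of radius `R * r` is
bounded independently of `r` and of the ball. -/
theorem exists_card_le_of_separated (d : ℕ) (R : ℝ) {δ : ℝ} (hδ : 0 < δ) :
    ∃ C : ℕ, ∀ (r : ℝ) (_ : 0 < r) (X : EuclideanSpace ℝ (Fin d)) {α : Type} (W : Finset α)
      (y : α → EuclideanSpace ℝ (Fin d)), (∀ w ∈ W, dist (y w) X ≤ R * r) →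
      (∀ w ∈ W, ∀ w' ∈ W, w ≠ w' → δ * r ≤ dist (y w) (y w')) → W.card ≤ C := by
  -- After rescaling by `r⁻¹` the points lie in a fixed ball and are `δ`-separated, so a ball of
  -- radius `δ / 2` holds at most one of them.
  obtain ⟨t, -, htf, ht⟩ := finite_cover_balls_of_compact
    (isCompact_closedBall (0 : EuclideanSpace ℝ (Fin d)) R) (half_pos hδ)
  refine ⟨htf.toFinset.card, fun r hr X α W y hy hsep => ?_⟩
  have hn : ∀ w w', dist (r⁻¹ • (y w - X)) (r⁻¹ • (y w' - X)) = r⁻¹ * dist (y w) (y w') := by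
    intro w w'
    rw [dist_smul₀, dist_sub_right, Real.norm_of_nonneg (inv_nonneg.2 hr.le)]
  have hc : ∀ w, ∃ z, w ∈ W → z ∈ t ∧ dist (r⁻¹ • (y w - X)) z < δ / 2 := by
    intro w
    by_cases hw : w ∈ W
    · have hmem : r⁻¹ • (y w - X) ∈ closedBall (0 : EuclideanSpace ℝ (Fin d)) R := by
        rw [mem_closedBall_zero_iff, norm_smul, Real.norm_of_nonneg (inv_nonneg.2 hr.le),
          ← dist_eq_norm, inv_mul_le_iff₀ hr, mul_comm]
        exact hy w hw
      obtain ⟨z, hz, hz'⟩ := mem_iUnion₂.1 (ht hmem)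
      exact ⟨z, fun _ => ⟨hz, hz'⟩⟩
    · exact ⟨0, fun h => absurd h hw⟩
  choose z hz using hc
  refine Finset.card_le_card_of_injOn z (fun w hw => by simpa using (hz w hw).1) ?_
  intro w hw w' hw' hzz
  by_contra hne
  have h1 := hsep w hw w' hw' hne
  have h2 := dist_triangle_right (r⁻¹ • (y w - X)) (r⁻¹ • (y w' - X)) (z w)
  have h3 := (hz w hw).2
  have h4 := (hz w' hw').2
  rw [← hzz] at h4
  rw [hn] at h2
  have h5 : δ ≤ r⁻¹ * dist (y w) (y w') := by
    rw [inv_mul_eq_div, le_div_iff₀ hr]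
    exact h1
  linarith

/-- Divided by its ratio, `f` is an isometry of a finite-dimensional Euclidean space into itself,
hence affine and onto. -/
theorem ContractingSimilitude.surjective (f : ContractingSimilitude d) :
    Function.Surjective f := by
  have hr := f.ratio_pos
  have hi : Isometry fun x => f.ratio⁻¹ • f x := by
    refine Isometry.of_dist_eq fun x y => ?_
    rw [dist_smul₀, f.dist_map, Real.norm_of_nonneg (inv_nonneg.2 hr.le), inv_mul_cancel_left₀ hr.ne']
  have hs : Function.Surjective fun x => f.ratio⁻¹ • f x :=
    (hi.affineIsometryOfStrictConvexSpace.toAffineIsometryEquiv rfl).surjective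
  intro y
  obtain ⟨x, hx⟩ := hs (f.ratio⁻¹ • y)
  exact ⟨x, smul_right_injective _ (inv_ne_zero hr.ne') hx⟩

theorem ContractingSimilitude.injective (f : ContractingSimilitude d) : Function.Injective f := by
  intro x y h
  have := f.dist_map x y
  rw [h, dist_self] at this
  exact dist_eq_zero.1 ((mul_eq_zero.1 this.symm).resolve_left f.ratio_pos.ne')

theorem wordMap_surjective {ι : Type*} (g : ι → ContractingSimilitude d) (w : List ι) :
    Function.Surjective (wordMap g w) := by
  induction w with
  | nil => exact fun x => ⟨x, rfl⟩
  | cons i w ih => exact (g i).surjective.comp ih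

theorem ball_subset_wordMap_image {ι : Type*} (g : ι → ContractingSimilitude d) (w : List ι)
    (z : EuclideanSpace ℝ (Fin d)) (ρ : ℝ) : ball (wordMap g w z) (wordRatio g w * ρ) ⊆ wordMap g w '' ball z ρ := by
  intro y hy
  obtain ⟨x, rfl⟩ := wordMap_surjective g w y
  rw [mem_ball, dist_wordMap] at hy
  exact ⟨x, lt_of_mul_lt_mul_left hy (wordRatio_pos g w).le, rfl⟩

theorem wordMap_mem {ι : Type*} (g : ι → ContractingSimilitude d) {U : Set (EuclideanSpace ℝ (Fin d))}
    (h : ∀ i, ∀ x ∈ U, g i x ∈ U) (w : List ι) {x : EuclideanSpace ℝ (Fin d)} (hx : x ∈ U) : wordMap g w x ∈ U := by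
  induction w with
  | nil => exact hx
  | cons i w ih => exact h i _ ih

/-- Incomparable words differ at a first letter; the images are separated there, and injectivity
removes the common prefix. -/
theorem disjoint_wordMap_image {ι : Type*} (g : ι → ContractingSimilitude d) {U : Set (EuclideanSpace ℝ (Fin d))}
    (h : ∀ i, ∀ x ∈ U, g i x ∈ U) (hd : ∀ i j, i ≠ j → Disjoint (g i '' U) (g j '' U))
    (u w : List ι) (huw : ¬ u <+: w) (hwu : ¬ w <+: u) :
    Disjoint (wordMap g u '' U) (wordMap g w '' U) := by
  rw [Set.disjoint_left]
  induction u generalizing w with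
  | nil => exact absurd (List.nil_prefix) huw
  | cons i u ih =>
    cases w with
    | nil => exact absurd (List.nil_prefix) hwu
    | cons j w =>
      rintro _ ⟨x, hx, rfl⟩ ⟨y, hy, hxy⟩
      by_cases hij : i = j
      · subst hij
        simp only [List.cons_prefix_cons, true_and] at huw hwu
        exact ih w huw hwu ⟨x, hx, rfl⟩ ⟨y, hy, (g i).injective hxy⟩
      · exact (Set.disjoint_left.1 (hd i j hij)) ⟨_, wordMap_mem g h u hx, rfl⟩
          ⟨_, wordMap_mem g h w hy, hxy⟩

theorem exists_pos_le_ratio {ι : Type*} [Finite ι] (g : ι → ContractingSimilitude d) :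
    ∃ c, 0 < c ∧ c ≤ 1 ∧ ∀ i, c ≤ (g i).ratio := by
  cases isEmpty_or_nonempty ι
  · exact ⟨1, one_pos, le_rfl, fun i => isEmptyElim i⟩
  · obtain ⟨i, hi⟩ := Finite.exists_min fun i => (g i).ratio
    exact ⟨_, (g i).ratio_pos, (g i).ratio_lt_one.le, hi⟩

theorem exists_ratio_le_lt_one {ι : Type*} [Finite ι] (g : ι → ContractingSimilitude d) :
    ∃ c, 0 ≤ c ∧ c < 1 ∧ ∀ i, (g i).ratio ≤ c := by
  cases isEmpty_or_nonempty ι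
  · exact ⟨0, le_rfl, one_pos, fun i => isEmptyElim i⟩
  · obtain ⟨i, hi⟩ := Finite.exists_max fun i => (g i).ratio
    exact ⟨_, (g i).ratio_pos.le, (g i).ratio_lt_one, hi⟩

theorem wordRatio_le_pow {ι : Type*} (g : ι → ContractingSimilitude d) {c : ℝ} (hc0 : 0 ≤ c)
    (hc : ∀ i, (g i).ratio ≤ c) (w : List ι) : wordRatio g w ≤ c ^ w.length := by
  induction w with
  | nil => simp [wordRatio]
  | cons i w ih =>
    rw [List.length_cons, pow_succ']
    exact mul_le_mul (hc i) ih (wordRatio_pos g w).le hc0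

/-- Under the open set condition, the number of cylinders of a given scale that come close to a
given point is bounded. -/
theorem IFS.OpenSetCondition.exists_card_le {S : IFS d N} (hS : S.OpenSetCondition) {K : Set (EuclideanSpace ℝ (Fin d))}
    (hK : Bornology.IsBounded K) :
    ∃ C : ℕ, ∀ (r : ℝ), 0 < r → r ≤ 1 → ∀ (X : EuclideanSpace ℝ (Fin d)) (W : Finset (List (Fin N))),
      (∀ w ∈ W, IsCutWord S r w ∧ ∃ x ∈ K, dist (wordMap S w x) X ≤ r) → W.card ≤ C := by
  obtain ⟨U, hUo, ⟨z, hz⟩, hU, hd⟩ := hS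
  have hU' : ∀ i, ∀ x ∈ U, S i x ∈ U := fun i x hx => hU (mem_iUnion.2 ⟨i, x, hx, rfl⟩)
  obtain ⟨ρ, hρ, hball⟩ := Metric.isOpen_iff.1 hUo z hz
  obtain ⟨D, hD⟩ := hK.subset_closedBall z
  obtain ⟨c, hc0, hc1, hc⟩ := exists_pos_le_ratio S
  -- The copy of `ball z ρ` along a cut word contains a ball of radius at least `c * ρ * r`.
  -- Distinct cut words give disjoint copies, so the images of `z` are separated by that distance.
  -- They lie within `(|D| + 1) * r` of `X`.
  obtain ⟨C, hC⟩ := exists_card_le_of_separated d (|D| + 1) (mul_pos hc0 hρ)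
  refine ⟨C, fun r hr hr1 X W hW => hC r hr X W (fun w => wordMap S w z) ?_ ?_⟩
  · intro w hw
    obtain ⟨hcut, x, hx, hxX⟩ := hW w hw
    have h1 : dist z x ≤ |D| := by
      rw [dist_comm]
      exact (hD hx).trans (le_abs_self D)
    calc dist (wordMap S w z) X ≤ dist (wordMap S w z) (wordMap S w x) + dist (wordMap S w x) X :=
          dist_triangle _ _ _
      _ ≤ r * |D| + r := by
          rw [dist_wordMap]
          exact add_le_add (mul_le_mul hcut.1 h1 dist_nonneg hr.le) hxX
      _ = (|D| + 1) * r := by ring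
  · intro w hw w' hw' hne
    have hdis := disjoint_wordMap_image S hU' hd w w'
      (fun h => hne ((hW w hw).1.eq_of_prefix S (hW w' hw').1 h))
      (fun h => hne ((hW w' hw').1.eq_of_prefix S (hW w hw).1 h).symm)
    have h1 : c * r ≤ wordRatio S w := (hW w hw).1.mul_le S hr1 hc hc0.le hc1
    by_contra! hlt
    refine Set.disjoint_left.1 hdis (image_mono hball (ball_subset_wordMap_image S w z ρ ?_))
      ⟨z, hz, rfl⟩
    rw [mem_ball, dist_comm]
    exact hlt.trans_le (by nlinarith)

end Packing

/-! ### Hausdorff measure of `K` in the similarity dimension -/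

section Hausdorff

variable {d N : ℕ}

/-- Intermediate values: the sum is `N ≥ 1` at exponent `0` and tends to `0` at infinity. -/
theorem IFS.exists_similarity_dimension [NeZero N] (S : IFS d N) :
    ∃ s : ℝ≥0, ∑ i, (S i).ratio ^ (s : ℝ) = 1 := by
  have hcont : Continuous fun t : ℝ => ∑ i, (S i).ratio ^ t :=
    continuous_finsetSum _ fun i _ => Real.continuous_const_rpow (S i).ratio_pos.ne'
  have hlim : Tendsto (fun t : ℝ => ∑ i, (S i).ratio ^ t) atTop (𝓝 0) := by
    have := tendsto_finsetSum (Finset.univ : Finset (Fin N)) fun i _ =>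
      tendsto_rpow_atTop_of_base_lt_one (S i).ratio (by linarith [(S i).ratio_pos])
        (S i).ratio_lt_one
    simpa using this
  obtain ⟨T, hT1, hT⟩ := ((eventually_ge_atTop 0).and (hlim.eventually_le_const one_pos)).exists
  have h0 : (1 : ℝ) ≤ ∑ i, (S i).ratio ^ (0 : ℝ) := by
    simp [Nat.one_le_iff_ne_zero, NeZero.ne N]
  obtain ⟨s, hs, hs1⟩ := intermediate_value_Icc' hT1 hcont.continuousOn ⟨hT, h0⟩
  exact ⟨⟨s, hs.1⟩, hs1⟩

variable {S : IFS d N} {K : Set (EuclideanSpace ℝ (Fin d))}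

theorem IFS.IsInvariantSet.map_mem (hK : S.IsInvariantSet K) (i : Fin N) (x : EuclideanSpace ℝ (Fin d)) (hx : x ∈ K) :
    S i x ∈ K := by
  rw [hK.2.2]
  exact mem_iUnion.2 ⟨i, x, hx, rfl⟩

theorem IFS.IsInvariantSet.exists_word (hK : S.IsInvariantSet K) (n : ℕ) {y : EuclideanSpace ℝ (Fin d)} (hy : y ∈ K) :
    ∃ x : Fin n → Fin N, y ∈ wordMap S (List.ofFn x) '' K := by
  suffices ∃ w : List (Fin N), w.length = n ∧ y ∈ wordMap S w '' K by
    obtain ⟨w, rfl, hw⟩ := this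
    exact ⟨w.get, by rwa [List.ofFn_get]⟩
  induction n generalizing y with
  | zero => exact ⟨[], rfl, y, hy, rfl⟩
  | succ n ih =>
    have hy' := hy
    rw [hK.2.2] at hy'
    obtain ⟨i, z, hz, rfl⟩ := mem_iUnion.1 hy'
    obtain ⟨w, rfl, x, hx, rfl⟩ := ih hz
    exact ⟨i :: w, rfl, x, hx, rfl⟩

theorem ediam_wordMap_image_le {ι : Type*} (g : ι → ContractingSimilitude d) (w : List ι)
    (A : Set (EuclideanSpace ℝ (Fin d))) : ediam (wordMap g w '' A) ≤ ENNReal.ofReal (wordRatio g w) * ediam A := by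
  have : LipschitzWith (wordRatio g w).toNNReal (wordMap g w) :=
    LipschitzWith.of_dist_le_mul fun x y => by
      rw [dist_wordMap, Real.coe_toNNReal _ (wordRatio_pos g w).le]
  exact this.ediam_image_le A

theorem ofReal_wordRatio_rpow {ι : Type*} (g : ι → ContractingSimilitude d) (s : ℝ)
    (w : List ι) : ENNReal.ofReal (wordRatio g w) ^ s =
      (w.map fun i => ENNReal.ofReal ((g i).ratio ^ s)).prod := by
  induction w with
  | nil => simp [wordRatio]
  | cons i w ih =>
    rw [wordRatio, ENNReal.ofReal_mul (g i).ratio_pos.le, ENNReal.mul_rpow_of_ne_top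
      ENNReal.ofReal_ne_top ENNReal.ofReal_ne_top, ih, List.map_cons, List.prod_cons,
      ENNReal.ofReal_rpow_of_pos (g i).ratio_pos]

theorem sum_ofReal_ratio_rpow {s : ℝ} (hs : ∑ i, (S i).ratio ^ s = 1) :
    ∑ i, ENNReal.ofReal ((S i).ratio ^ s) = 1 := by
  rw [← ENNReal.ofReal_sum_of_nonneg fun i _ => Real.rpow_nonneg (S i).ratio_pos.le s, hs,
    ENNReal.ofReal_one]

/-- The cylinders of level `n` cover `K`, and their `s`-th powers of diameters sum to at most `(∑
c_i ^ s) ^ n * ediam K ^ s = ediam K ^ s`. -/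
theorem IFS.IsInvariantSet.hausdorffMeasure_lt_top (hK : S.IsInvariantSet K) {s : ℝ} (hs0 : 0 ≤ s)
    (hs : ∑ i, (S i).ratio ^ s = 1) : μH[s] K < ⊤ := by
  have hdiam : ediam K ≠ ⊤ := hK.2.1.isBounded.ediam_ne_top
  obtain ⟨c, hc0, hc1, hc⟩ := exists_ratio_le_lt_one S
  refine lt_of_le_of_lt ((Measure.hausdorffMeasure_le_liminf_sum (ι := fun n => Fin n → Fin N) s K
    (l := atTop) (fun n => ENNReal.ofReal c ^ n * ediam K) ?_
    (fun n x => wordMap S (List.ofFn x) '' K) ?_ ?_).trans ?_)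
    (ENNReal.rpow_lt_top_of_nonneg hs0 hdiam)
  · have h := ENNReal.tendsto_pow_atTop_nhds_zero_of_lt_one
      (r := ENNReal.ofReal c) (by simpa using hc1)
    simpa using ENNReal.Tendsto.mul_const h (Or.inr hdiam)
  · refine Eventually.of_forall fun n x => (ediam_wordMap_image_le S _ K).trans ?_
    refine mul_le_mul_left ?_ _
    rw [← ENNReal.ofReal_pow hc0]
    refine ENNReal.ofReal_le_ofReal ?_
    simpa using wordRatio_le_pow S hc0 hc (List.ofFn x)
  · exact Eventually.of_forall fun n y hy => mem_iUnion.2 (hK.exists_word n hy)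
  · refine liminf_le_of_le (by isBoundedDefault) fun b hb => ?_
    obtain ⟨n, hn⟩ := hb.exists
    refine hn.trans ?_
    calc ∑ x : Fin n → Fin N, ediam (wordMap S (List.ofFn x) '' K) ^ s
        ≤ ∑ x : Fin n → Fin N, (∏ k, ENNReal.ofReal ((S (x k)).ratio ^ s)) * ediam K ^ s := by
          refine Finset.sum_le_sum fun x _ => ?_
          refine (ENNReal.rpow_le_rpow (ediam_wordMap_image_le S _ K) hs0).trans_eq ?_
          rw [ENNReal.mul_rpow_of_nonneg _ _ hs0, ofReal_wordRatio_rpow, List.map_ofFn,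
            List.prod_ofFn]
          rfl
      _ = ediam K ^ s := by
          rw [← Finset.sum_mul, ← Fintype.sum_pow (fun i => ENNReal.ofReal ((S i).ratio ^ s)) n,
            sum_ofReal_ratio_rpow hs, one_pow, one_mul]

/-- Nested nonempty compact cylinders have a common point. Any choice of it will do; no regularity
of `π` is needed. -/
theorem IFS.IsInvariantSet.exists_code_map (hK : S.IsInvariantSet K) :
    ∃ π : (ℕ → Fin N) → EuclideanSpace ℝ (Fin d), ∀ x n, π x ∈ wordMap S ((List.range n).map x) '' K := by
  have : ∀ x : ℕ → Fin N, (⋂ n, wordMap S ((List.range n).map x) '' K).Nonempty := by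
    intro x
    have hcomp : ∀ n, IsCompact (wordMap S ((List.range n).map x) '' K) := fun n =>
      hK.2.1.image (LipschitzWith.of_dist_le_mul (K := (wordRatio S _).toNNReal) fun x y => by
        rw [dist_wordMap, Real.coe_toNNReal _ (wordRatio_pos S _).le]).continuous
    refine IsCompact.nonempty_iInter_of_sequence_nonempty_isCompact_isClosed _ (fun n => ?_)
      (fun n => hK.1.image _) (hcomp 0) fun n => (hcomp n).isClosed
    rintro _ ⟨y, hy, rfl⟩
    rw [List.range_succ, List.map_append, wordMap_append]
    exact ⟨_, hK.map_mem (x n) y hy, rfl⟩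
  choose π hπ using this
  exact ⟨π, fun x n => mem_iInter.1 (hπ x) n⟩

/-- Mass distribution principle: code space carries the product of the weights `c_i ^ s`, and a set
of diameter at most `r` meets at most `C` cylinders of scale `r`, each of mass at most `r ^ s`. -/
theorem IFS.IsInvariantSet.hausdorffMeasure_pos (hK : S.IsInvariantSet K)
    (hS : S.OpenSetCondition) {s : ℝ} (hs0 : 0 ≤ s) (hs : ∑ i, (S i).ratio ^ s = 1) :
    0 < μH[s] K := by
  classical
  obtain ⟨π, hπ⟩ := hK.exists_code_map
  obtain ⟨C, hC⟩ := hS.exists_card_le hK.2.1.isBounded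
  obtain ⟨c, hc0, hc1, hc⟩ := exists_ratio_le_lt_one S
  let ν : Measure (Fin N) := (PMF.ofFintype _ (sum_ofReal_ratio_rpow hs)).toMeasure
  have hν : ∀ i, ν {i} = ENNReal.ofReal ((S i).ratio ^ s) := fun i => by
    simp [ν]
  let μ : Measure (ℕ → Fin N) := Measure.infinitePi fun _ => ν
  have hcyl : ∀ w : List (Fin N), μ {x | (List.range w.length).map x = w} ≤
      ENNReal.ofReal (wordRatio S w) ^ s := by
    intro w
    rcases eq_empty_or_nonempty {x : ℕ → Fin N | (List.range w.length).map x = w} with h | ⟨x₀, h₀⟩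
    · rw [h]
      simp
    · have hset : {x : ℕ → Fin N | (List.range w.length).map x = w} =
          Set.pi (Finset.range w.length) fun k => {x₀ k} := by
        ext x
        have h₀' : (List.range w.length).map x₀ = w := h₀
        rw [mem_ofPred_eq]
        conv_lhs => rhs; rw [← h₀']
        simp [List.map_inj_left]
      rw [hset, Measure.infinitePi_pi _ fun _ _ => measurableSet_singleton _]
      have h₀' : (List.range w.length).map x₀ = w := h₀
      conv_rhs => rw [← h₀']
      rw [ofReal_wordRatio_rpow, List.map_map, ← List.prod_toFinset _ List.nodup_range,
        List.toFinset_range]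
      simp [hν]
  have hbound : ∀ (A : Set (EuclideanSpace ℝ (Fin d))) (r : ℝ), 0 < r → r ≤ 1 → ediam A ≤ ENNReal.ofReal r →
      μ (π ⁻¹' A) ≤ C * ENNReal.ofReal r ^ s := by
    intro A r hr hr1 hA
    rcases A.eq_empty_or_nonempty with rfl | ⟨X, hX⟩
    · simp
    have hAr : ∀ y ∈ A, dist y X ≤ r := fun y hy => by
      rw [← ENNReal.ofReal_le_ofReal_iff hr.le, ← edist_dist]
      exact (edist_le_ediam_of_mem hy hX).trans hA
    let W : Set (List (Fin N)) :=
      {w | IsCutWord S r w ∧ ∃ x ∈ K, dist (wordMap S w x) X ≤ r}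
    have hWfin : W.Finite := by
      by_contra hinf
      obtain ⟨T, hT, hTc⟩ := (show W.Infinite from hinf).exists_subset_card_eq (C + 1)
      have := hC r hr hr1 X T fun w hw => hT hw
      omega
    have hsub : π ⁻¹' A ⊆ ⋃ w ∈ hWfin.toFinset, {x | (List.range w.length).map x = w} := by
      intro x hx
      obtain ⟨n, hn⟩ := exists_pow_lt_of_lt_one hr hc1
      obtain ⟨p, hp, hpcut⟩ := exists_isCutWord_prefix S ((List.range n).map x) (r := r)
        ((wordRatio_le_pow S hc0 hc _).trans (by simpa using hn.le))
      have hpx : (List.range p.length).map x = p := by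
        have hle := hp.length_le
        rw [List.length_map, List.length_range] at hle
        rw [List.prefix_iff_eq_take.1 hp]
        simp [← List.map_take, List.take_range, hle]
      obtain ⟨k, hk, hkx⟩ := hπ x p.length
      rw [hpx] at hkx
      exact mem_iUnion₂.2 ⟨p, hWfin.mem_toFinset.2 ⟨hpcut, k, hk, hkx ▸ hAr _ hx⟩, hpx⟩
    calc μ (π ⁻¹' A) ≤ ∑ w ∈ hWfin.toFinset, μ {x | (List.range w.length).map x = w} :=
          (measure_mono hsub).trans (measure_biUnion_finset_le _ _)
      _ ≤ ∑ w ∈ hWfin.toFinset, ENNReal.ofReal r ^ s := by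
          refine Finset.sum_le_sum fun w hw => (hcyl w).trans ?_
          exact ENNReal.rpow_le_rpow
            (ENNReal.ofReal_le_ofReal (hWfin.mem_toFinset.1 hw).1.1) hs0
      _ ≤ C * ENNReal.ofReal r ^ s := by
          rw [Finset.sum_const, nsmul_eq_mul]
          gcongr
          exact hC r hr hr1 X _ fun w hw => hWfin.mem_toFinset.1 hw
  -- An outer measure can be pushed forward without measurability of `π`.
  let m : OuterMeasure (EuclideanSpace ℝ (Fin d)) := OuterMeasure.map π μ.toOuterMeasure
  have hm : m ≤ OuterMeasure.mkMetric fun t => C * t ^ s := by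
    refine OuterMeasure.le_mkMetric _ _ (ENNReal.ofReal (1 / 2)) (by simp) fun A hA => ?_
    have hne : ediam A ≠ ⊤ := ne_top_of_le_ne_top ENNReal.ofReal_ne_top hA
    -- The diameter may be `0`, whereas `hbound` needs a positive scale; so the scale decreases to
    -- the diameter. The cutoff `1 / 2` leaves room for scales up to `1`.
    have hlim : Tendsto (fun r : ℝ => (C : ENNReal) * ENNReal.ofReal r ^ s)
        (𝓝[>] (ediam A).toReal) (𝓝 (C * ENNReal.ofReal (ediam A).toReal ^ s)) := by
      refine Tendsto.mono_left ?_ nhdsWithin_le_nhds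
      refine ENNReal.Tendsto.const_mul ?_ (Or.inr (ENNReal.natCast_ne_top C))
      exact ((ENNReal.continuous_rpow_const.comp ENNReal.continuous_ofReal).tendsto _)
    rw [ENNReal.ofReal_toReal hne] at hlim
    refine ge_of_tendsto hlim ?_
    have hlt : (ediam A).toReal < 1 :=
      (ENNReal.toReal_le_of_le_ofReal (by norm_num) hA).trans_lt (by norm_num)
    filter_upwards [Ioc_mem_nhdsGT hlt] with r hr
    exact hbound A r (ENNReal.toReal_nonneg.trans_lt hr.1) hr.2
      ((ENNReal.le_ofReal_iff_toReal_le hne (ENNReal.toReal_nonneg.trans hr.1.le)).2 hr.1.le)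
  have hmK : (1 : ENNReal) ≤ m K := by
    have : π ⁻¹' K = univ := eq_univ_of_forall fun x => by
      obtain ⟨k, hk, hkx⟩ := hπ x 0
      rw [mem_preimage, ← hkx]
      exact hk
    simp [m, this, μ]
  rw [pos_iff_ne_zero]
  intro h0
  -- The factor `C + 1` replaces `C` because it must be nonzero.
  have h1 := Measure.mkMetric_mono_smul (X := EuclideanSpace ℝ (Fin d)) (m₁ := fun t => C * t ^ s)
    (m₂ := fun t => t ^ s) (c := (C : ENNReal) + 1) (by finiteness) (by simp)
    (Eventually.of_forall fun t => by
      simp only [Pi.smul_apply, smul_eq_mul]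
      gcongr
      exact le_self_add) K
  have h2 := hm K
  rw [OuterMeasure.coe_mkMetric] at h2
  have h3 : (Measure.mkMetric fun t => t ^ s : Measure (EuclideanSpace ℝ (Fin d))) K = 0 := h0
  rw [Measure.smul_apply, h3, smul_zero] at h1
  exact absurd (hmK.trans (h2.trans h1)) (by simp)

end Hausdorff

/-! ### Comparing sets by contraction -/

section Contraction

variable {d : ℕ} {V : Type*}

/-- If every point of `E u` comes from some `E v` by a contraction that maps `E' v` into `E' u`,
where the `E u` are bounded and the `E' u` closed, then `E u ⊆ E' u`. -/
theorem subset_of_contraction [Finite V] {E E' : V → Set (EuclideanSpace ℝ (Fin d))}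
    (hE : ∀ u, Bornology.IsBounded (E u)) (hE' : ∀ u, IsClosed (E' u))
    (hne : ∀ u, (E' u).Nonempty) {c : ℝ} (hc0 : 0 ≤ c) (hc1 : c < 1)
    (h : ∀ u, ∀ x ∈ E u, ∃ (v : V) (f : ContractingSimilitude d), f.ratio ≤ c ∧
      (∃ y ∈ E v, f y = x) ∧ ∀ z ∈ E' v, f z ∈ E' u) (u : V) : E u ⊆ E' u := by
  choose z hz using hne
  have hbd : ∃ D, ∀ u, ∀ x ∈ E u, dist x (z u) ≤ D := by
    have : ∀ u, ∃ D, ∀ x ∈ E u, dist x (z u) ≤ D := fun u =>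
      (hE u).subset_closedBall (z u) |>.imp fun D hD x hx => hD hx
    choose D hD using this
    obtain ⟨D', hD'⟩ := (finite_range D).bddAbove
    exact ⟨D', fun u x hx => (hD u x hx).trans (hD' ⟨u, rfl⟩)⟩
  obtain ⟨D, hD⟩ := hbd
  -- Pulling `x` back through `n` contractions, picking any point of the target there and pushing it
  -- forward gives error `c ^ n * D`.
  have key : ∀ n : ℕ, ∀ u, ∀ x ∈ E u, ∃ y ∈ E' u, dist x y ≤ c ^ n * D := by
    intro n
    induction n with
    | zero => exact fun u x hx => ⟨z u, hz u, by simpa using hD u x hx⟩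
    | succ n ih =>
      intro u x hx
      obtain ⟨v, f, hf, ⟨y, hy, rfl⟩, hmaps⟩ := h u x hx
      obtain ⟨y', hy', hyy⟩ := ih v y hy
      refine ⟨f y', hmaps y' hy', ?_⟩
      rw [f.dist_map, pow_succ', mul_assoc]
      exact mul_le_mul hf hyy dist_nonneg hc0
  intro x hx
  rw [← (hE' u).closure_eq, Metric.mem_closure_iff]
  intro ε hε
  have hlim : Tendsto (fun n : ℕ => c ^ n * D) atTop (𝓝 0) := by
    simpa using (tendsto_pow_atTop_nhds_zero_of_lt_one hc0 hc1).mul_const D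
  obtain ⟨n, hn⟩ := (hlim.eventually_lt_const hε).exists
  obtain ⟨y, hy, hxy⟩ := key n u x hx
  exact ⟨y, hy, hxy.trans_lt hn⟩

end Contraction

/-! ### From bounded neighbor counts to the open set condition -/

namespace GIFS

variable {d : ℕ} {V : Type*} (G : GIFS d V)

/-- `w` is a path of the directed graph underlying `G` that starts at the state `u`. -/
def IsPathFrom : V → List G.Edge → Prop
  | _, [] => True
  | u, e :: w => G.src e = u ∧ IsPathFrom (G.tgt e) w

/-- The state where a path from `u` ends. -/
def endState : V → List G.Edge → V
  | u, [] => u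
  | _, e :: w => endState (G.tgt e) w

variable {G}

theorem isPathFrom_append {u : V} {p q : List G.Edge} :
    G.IsPathFrom u (p ++ q) ↔ G.IsPathFrom u p ∧ G.IsPathFrom (G.endState u p) q := by
  induction p generalizing u with
  | nil => simp [IsPathFrom, endState]
  | cons e p ih => simp [IsPathFrom, endState, ih, and_assoc]

theorem endState_append (u : V) (p q : List G.Edge) :
    G.endState u (p ++ q) = G.endState (G.endState u p) q := by
  induction p generalizing u with
  | nil => rfl
  | cons e p ih => exact ih _

theorem IsInvariantFamily.map_mem {E : V → Set (EuclideanSpace ℝ (Fin d))}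
    (hE : G.IsInvariantFamily E) (e : G.Edge) {x : EuclideanSpace ℝ (Fin d)}
    (hx : x ∈ E (G.tgt e)) : G.map e x ∈ E (G.src e) := by
  rw [hE.2]
  exact mem_iUnion₂.2 ⟨e, rfl, x, hx, rfl⟩

theorem IsInvariantFamily.exists_edge {E : V → Set (EuclideanSpace ℝ (Fin d))}
    (hE : G.IsInvariantFamily E) {u : V} {x : EuclideanSpace ℝ (Fin d)} (hx : x ∈ E u) :
    ∃ e, G.src e = u ∧ ∃ y ∈ E (G.tgt e), G.map e y = x := by
  rw [hE.2] at hx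
  obtain ⟨e, he, y, hy, rfl⟩ := mem_iUnion₂.1 hx
  exact ⟨e, he, y, hy, rfl⟩

theorem IsInvariantFamily.wordMap_mem {E : V → Set (EuclideanSpace ℝ (Fin d))}
    (hE : G.IsInvariantFamily E) {u : V} {w : List G.Edge} (hw : G.IsPathFrom u w)
    {x : EuclideanSpace ℝ (Fin d)} (hx : x ∈ E (G.endState u w)) : wordMap G.map w x ∈ E u := by
  induction w generalizing u with
  | nil => exact hx
  | cons e w ih =>
    obtain ⟨rfl, hw⟩ := hw
    exact hE.map_mem e (ih hw hx)

/-- The paths from `u` of the same scale as the path `w` whose cylinders come close to a base point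
of the cylinder of `w`. -/
def neighbors (E : V → Set (EuclideanSpace ℝ (Fin d))) (x : V → EuclideanSpace ℝ (Fin d)) (u : V)
    (w : List G.Edge) : Set (List G.Edge) :=
  {l | G.IsPathFrom u l ∧ IsCutWord G.map (wordRatio G.map w) l ∧ ∃ y ∈ E (G.endState u l),
    dist (wordMap G.map l y) (wordMap G.map w (x (G.endState u w))) < wordRatio G.map w}

/-- A common first edge multiplies distances and scales by the same ratio, so neighbors stay
neighbors. -/
theorem cons_image_neighbors_subset (E : V → Set (EuclideanSpace ℝ (Fin d)))
    (x : V → EuclideanSpace ℝ (Fin d)) (e : G.Edge) (w : List G.Edge) :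
    (e :: ·) '' neighbors E x (G.tgt e) w ⊆ neighbors E x (G.src e) (e :: w) := by
  rintro _ ⟨l, ⟨hl, hcut, y, hy, hyw⟩, rfl⟩
  refine ⟨⟨rfl, hl⟩, hcut.cons _ (wordRatio_le_one _ _) e, y, hy, ?_⟩
  simp only [wordMap, wordRatio, (G.map e).dist_map]
  exact mul_lt_mul_of_pos_left hyw (G.map e).ratio_pos

theorem ncard_neighbors_le {E : V → Set (EuclideanSpace ℝ (Fin d))}
    {x : V → EuclideanSpace ℝ (Fin d)} (hfin : ∀ u w, (neighbors (G := G) E x u w).Finite) (u : V)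
    (p w : List G.Edge) (hp : G.IsPathFrom u p) :
    (neighbors E x (G.endState u p) w).ncard ≤ (neighbors E x u (p ++ w)).ncard := by
  induction p generalizing u with
  | nil => exact le_rfl
  | cons e p ih =>
    obtain ⟨rfl, hp⟩ := hp
    refine (ih _ hp).trans ?_
    rw [← ncard_image_of_injective _ (List.cons_injective (a := e))]
    exact ncard_le_ncard (cons_image_neighbors_subset E x e _) (hfin _ _)

/-- The open set condition holds if states that are joined by an edge are mutually reachable, and
if a bounded number of cylinders of the same scale come close to any point. -/
theorem IsInvariantFamily.openSetCondition {E : V → Set (EuclideanSpace ℝ (Fin d))}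
    (hE : G.IsInvariantFamily E)
    (hreach : ∀ e, ∃ p, G.IsPathFrom (G.tgt e) p ∧ G.endState (G.tgt e) p = G.src e)
    {C : ℕ} (hC : ∀ (u : V) (r : ℝ), 0 < r → r ≤ 1 → ∀ (X : EuclideanSpace ℝ (Fin d))
      (W : Finset (List G.Edge)), (∀ w ∈ W, G.IsPathFrom u w ∧ IsCutWord G.map r w ∧
        ∃ y ∈ E (G.endState u w), dist (wordMap G.map w y) X ≤ r) → W.card ≤ C) :
    G.OpenSetCondition := by
  choose x hx using fun u => (hE.1 u).1
  have hcard : ∀ u w (T : Finset (List G.Edge)), (T : Set _) ⊆ neighbors (G := G) E x u w → T.card ≤ C := by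
    intro u w T hT
    refine hC u _ (wordRatio_pos G.map w) (wordRatio_le_one G.map w)
      (wordMap G.map w (x (G.endState u w))) T fun l hl => ?_
    obtain ⟨h1, h2, y, hy, hyl⟩ := hT hl
    exact ⟨h1, h2, y, hy, hyl.le⟩
  have hfin : ∀ u w, (neighbors (G := G) E x u w).Finite := by
    intro u w
    by_contra hinf
    obtain ⟨T, hT, hTc⟩ := Set.Infinite.exists_subset_card_eq hinf (C + 1)
    have := hcard u w T hT
    omega
  have hle : ∀ u w, (neighbors (G := G) E x u w).ncard ≤ C := by
    intro u w
    rw [ncard_eq_toFinset_card _ (hfin u w)]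
    exact hcard u w _ (by simp)
  -- The paths from `u` with the most neighbors; the maximum exists since the counts are at most
  -- `C`.
  let Max : V → Set (List G.Edge) := fun u => {w | G.IsPathFrom u w ∧ ∀ w', G.IsPathFrom u w' →
    (neighbors (G := G) E x u w').ncard ≤ (neighbors (G := G) E x u w).ncard}
  have hMax : ∀ u, (Max u).Nonempty := by
    intro u
    have hbdd : BddAbove ((fun w => (neighbors (G := G) E x u w).ncard) '' {w | G.IsPathFrom u w}) :=
      ⟨C, by rintro _ ⟨w, -, rfl⟩; exact hle u w⟩
    obtain ⟨w, hw, hw'⟩ := Nat.sSup_mem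
      (Set.Nonempty.image _ (show {w | G.IsPathFrom u w}.Nonempty from ⟨[], trivial⟩)) hbdd
    refine ⟨w, hw, fun w' hw'' => ?_⟩
    exact (le_csSup hbdd ⟨w', hw'', rfl⟩).trans_eq hw'.symm
  -- A return path from `tgt e` to `src e`, put in front of `w'`, shows that the maximum at `tgt e`
  -- is no smaller than at `src e`.
  have hstep : ∀ e, ∀ w ∈ Max (G.tgt e), ∀ w', G.IsPathFrom (G.src e) w' →
      (neighbors E x (G.src e) w').ncard ≤ (neighbors E x (G.tgt e) w).ncard := by
    intro e w hw w' hw'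
    obtain ⟨p, hp, hpe⟩ := hreach e
    have h1 := ncard_neighbors_le hfin _ p w' hp
    rw [hpe] at h1
    exact h1.trans (hw.2 _ (isPathFrom_append.2 ⟨hp, hpe ▸ hw'⟩))
  -- The two maxima agree, so the inclusion of neighbor sets is an equality: every neighbor of `e ::
  -- w` starts with `e`.
  have hcons : ∀ e, ∀ w ∈ Max (G.tgt e), e :: w ∈ Max (G.src e) ∧
      neighbors E x (G.src e) (e :: w) = (e :: ·) '' neighbors E x (G.tgt e) w := by
    intro e w hw
    have hpath : G.IsPathFrom (G.src e) (e :: w) := ⟨rfl, hw.1⟩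
    refine ⟨⟨hpath, fun w' hw' => (hstep e w hw w' hw').trans ?_⟩, ?_⟩
    · exact ncard_neighbors_le hfin (G.src e) [e] w ⟨rfl, trivial⟩
    · refine (Set.eq_of_subset_of_ncard_le (cons_image_neighbors_subset E x e w) ?_ (hfin _ _)).symm
      rw [ncard_image_of_injective _ (List.cons_injective (a := e))]
      exact hstep e w hw _ hpath
  -- If the balls met, their centers would be closer than the larger ratio, that of `e :: w`. The
  -- prefix of `f :: w'` cut at this scale would then be a neighbor of `e :: w`, so it would start
  -- with `e`, forcing `e = f`.
  have hsep : ∀ e f, e ≠ f → G.src e = G.src f → ∀ w ∈ Max (G.tgt e), ∀ w' ∈ Max (G.tgt f),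
      wordRatio G.map (f :: w') ≤ wordRatio G.map (e :: w) →
      Disjoint
        (ball (wordMap G.map (e :: w) (x (G.endState (G.src e) (e :: w))))
          (wordRatio G.map (e :: w) / 2))
        (ball (wordMap G.map (f :: w') (x (G.endState (G.src f) (f :: w'))))
          (wordRatio G.map (f :: w') / 2)) := by
    intro e f hef hsrc w hw w' hw' hrat
    rw [Set.disjoint_left]
    intro z hz hz'
    obtain ⟨p, ⟨q, hq⟩, hcut⟩ := exists_isCutWord_prefix G.map (f :: w') hrat
    have hpath : G.IsPathFrom (G.src f) (p ++ q) := by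
      rw [hq]
      exact ⟨rfl, hw'.1⟩
    rw [isPathFrom_append] at hpath
    have hmem : p ∈ neighbors E x (G.src e) (e :: w) := by
      rw [hsrc]
      refine ⟨hpath.1, hcut, wordMap G.map q (x (G.endState (G.src f) (f :: w'))),
        hE.wordMap_mem hpath.2 ?_, ?_⟩
      · rw [← endState_append, hq]
        exact hx _
      · rw [← wordMap_append, hq, ← hsrc]
        have h1 := dist_triangle_left
          (wordMap G.map (f :: w') (x (G.endState (G.src f) (f :: w'))))
          (wordMap G.map (e :: w) (x (G.endState (G.src e) (e :: w)))) z
        rw [mem_ball] at hz hz'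
        rw [hsrc] at hz h1 ⊢
        linarith
    rw [(hcons e w hw).2] at hmem
    obtain ⟨l, -, rfl⟩ := hmem
    have : e = f := by simpa using (List.cons.inj hq).1
    exact hef this
  have himage : ∀ e w, G.map e '' ball (wordMap G.map w (x (G.endState (G.tgt e) w)))
      (wordRatio G.map w / 2) ⊆ ball (wordMap G.map (e :: w)
        (x (G.endState (G.src e) (e :: w)))) (wordRatio G.map (e :: w) / 2) := by
    rintro e w _ ⟨z, hz, rfl⟩
    simp only [wordMap, wordRatio, endState, mem_ball, (G.map e).dist_map, mul_div_assoc] at hz ⊢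
    exact mul_lt_mul_of_pos_left hz (G.map e).ratio_pos
  refine ⟨fun u => ⋃ w ∈ Max u, ball (wordMap G.map w (x (G.endState u w)))
    (wordRatio G.map w / 2), fun u => ⟨isOpen_biUnion fun _ _ => isOpen_ball, ?_⟩, ?_, ?_⟩
  · obtain ⟨w, hw⟩ := hMax u
    exact ⟨_, mem_iUnion₂.2 ⟨w, hw, mem_ball_self (half_pos (wordRatio_pos G.map w))⟩⟩
  · rintro e _ ⟨z, hz, rfl⟩
    obtain ⟨w, hw, hz⟩ := mem_iUnion₂.1 hz
    exact mem_iUnion₂.2 ⟨e :: w, (hcons e w hw).1, himage e w ⟨z, hz, rfl⟩⟩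
  · intro e f hef hsrc
    rw [Set.disjoint_left]
    rintro _ ⟨z, hz, rfl⟩ ⟨z', hz', hzz⟩
    obtain ⟨w, hw, hz⟩ := mem_iUnion₂.1 hz
    obtain ⟨w', hw', hz'⟩ := mem_iUnion₂.1 hz'
    have h1 := himage e w ⟨z, hz, rfl⟩
    have h2 := himage f w' ⟨z', hz', rfl⟩
    rw [hzz] at h2
    rcases le_total (wordRatio G.map (f :: w')) (wordRatio G.map (e :: w)) with h | h
    · exact Set.disjoint_left.1 (hsep e f hef hsrc w hw w' hw' h) h1 h2
    · exact Set.disjoint_left.1 (hsep f e hef.symm hsrc.symm w' hw' w hw h) h2 h1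

end GIFS

/-! ### Combinatorics of the induced GIFS -/

section InducedGIFS

variable {d N m : ℕ} {S : IFS d N} {Q : Fin m → List (CopyEdge N m)}

@[simp]
theorem OrientedEdge.rev_rev (v : OrientedEdge m) : v.rev.rev = v := by
  simp [OrientedEdge.rev]

theorem reverse_edge_injective :
    Function.Injective fun e : CopyEdge N m => ((e.1, e.2.rev) : CopyEdge N m) := by
  intro e f h
  have h1 := congrArg (fun e : CopyEdge N m => ((e.1, e.2.rev) : CopyEdge N m)) h
  simpa using h1

theorem mem_reversePath {P : List (CopyEdge N m)} {e : CopyEdge N m} :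
    e ∈ reversePath P ↔ (e.1, e.2.rev) ∈ P := by
  rw [reversePath, List.mem_reverse, List.mem_map]
  constructor
  · rintro ⟨f, hf, rfl⟩
    simpa using hf
  · exact fun h => ⟨_, h, by simp⟩

theorem mem_fineSubstitution_one {j : Fin m} {e : CopyEdge N m} :
    e ∈ fineSubstitution Q (j, 1) ↔ e ∈ Q j := by
  simp [fineSubstitution]

theorem mem_fineSubstitution_neg_one {j : Fin m} {e : CopyEdge N m} :
    e ∈ fineSubstitution Q (j, -1) ↔ (e.1, e.2.rev) ∈ Q j := by
  have : (-1 : ℤˣ) ≠ 1 := by decide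
  simp [fineSubstitution, this, mem_reversePath]

theorem mem_fineSubstitution_rev {u : OrientedEdge m} {e : CopyEdge N m} :
    (e.1, e.2.rev) ∈ fineSubstitution Q u.rev ↔ e ∈ fineSubstitution Q u := by
  obtain ⟨j, ε⟩ := u
  rcases Int.units_eq_one_or ε with rfl | rfl
  · have : OrientedEdge.rev (j, 1) = (j, -1) := rfl
    rw [this, mem_fineSubstitution_one, mem_fineSubstitution_neg_one, OrientedEdge.rev_rev]
  · have : OrientedEdge.rev (j, -1) = (j, 1) := by simp [OrientedEdge.rev]
    rw [this, mem_fineSubstitution_one, mem_fineSubstitution_neg_one]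

/-- The edge of the induced graph `G(S, A, β)`, up to orientation, that an edge of the induced GIFS
comes from. -/
def edgeCode (S : IFS d N) (Q : Fin m → List (CopyEdge N m)) (b : (inducedGIFS S Q).Edge) :
    CopyEdge N m :=
  (fineSubstitution Q b.1).get b.2

theorem inducedGIFS_map : (inducedGIFS S Q).map = S ∘ fun b => (edgeCode S Q b).1 := rfl

theorem inducedGIFS_tgt (b : (inducedGIFS S Q).Edge) :
    (inducedGIFS S Q).tgt b = (edgeCode S Q b).2 := rfl

theorem edgeCode_mem (b : (inducedGIFS S Q).Edge) :
    edgeCode S Q b ∈ fineSubstitution Q ((inducedGIFS S Q).src b) :=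
  List.get_mem _ _

theorem exists_edgeCode_eq {u : OrientedEdge m} {e : CopyEdge N m}
    (he : e ∈ fineSubstitution Q u) :
    ∃ b : (inducedGIFS S Q).Edge, (inducedGIFS S Q).src b = u ∧ edgeCode S Q b = e := by
  obtain ⟨k, hk⟩ := List.mem_iff_get.1 he
  exact ⟨⟨u, k⟩, rfl, hk⟩

/-- The reversal `v ↦ v⁻¹` is a symmetry of the GIFS that keeps the similitudes. -/
theorem exists_reverse_edge (b : (inducedGIFS S Q).Edge) :
    ∃ b' : (inducedGIFS S Q).Edge, (inducedGIFS S Q).src b' = ((inducedGIFS S Q).src b).rev ∧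
      (inducedGIFS S Q).tgt b' = ((inducedGIFS S Q).tgt b).rev ∧
      (inducedGIFS S Q).map b' = (inducedGIFS S Q).map b := by
  obtain ⟨b', h1, h2⟩ := exists_edgeCode_eq (S := S)
    (mem_fineSubstitution_rev.2 (edgeCode_mem (S := S) (Q := Q) b))
  refine ⟨b', h1, ?_, ?_⟩
  · rw [inducedGIFS_tgt, h2, inducedGIFS_tgt]
  · simp only [inducedGIFS_map, Function.comp, h2]

section Consistent

variable [NeZero m] {a : Fin m → EuclideanSpace ℝ (Fin d)} {β : Fin N → ℤˣ}
  {P : List (CopyEdge N m)}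

theorem IsConsistentPartition.exists_mem_iff (h : IsConsistentPartition S a β P Q)
    (e : CopyEdge N m) : (∃ j, e ∈ Q j) ↔ e.2.2 = β e.1 := by
  have h1 := h.unicursal.2.2 e
  rw [h.eq_concat, List.mem_flatten] at h1
  simpa [orientedGraph] using h1

theorem IsConsistentPartition.nodup (h : IsConsistentPartition S a β P Q) (j : Fin m) :
    (Q j).Nodup := by
  have h1 := h.unicursal.2.1
  rw [h.eq_concat, List.nodup_flatten] at h1
  exact h1.1 _ (List.mem_ofFn.2 ⟨j, rfl⟩)

theorem IsConsistentPartition.nodup_fineSubstitution (h : IsConsistentPartition S a β P Q)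
    (u : OrientedEdge m) : (fineSubstitution Q u).Nodup := by
  unfold fineSubstitution
  split_ifs
  · exact h.nodup _
  · exact List.nodup_reverse.2 ((h.nodup _).map reverse_edge_injective)

/-- The orientation `β` tells whether an edge belongs to a path `P_j` or to a reversed one. This is
what makes the sign of the source recoverable from the edge. -/
theorem IsConsistentPartition.sign_eq (h : IsConsistentPartition S a β P Q)
    {u : OrientedEdge m} {e : CopyEdge N m} (he : e ∈ fineSubstitution Q u) :
    e.2.2 = u.2 * β e.1 := by
  obtain ⟨j, ε⟩ := u
  rcases Int.units_eq_one_or ε with rfl | rfl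
  · rw [mem_fineSubstitution_one] at he
    rw [one_mul]
    exact (h.exists_mem_iff e).1 ⟨j, he⟩
  · rw [mem_fineSubstitution_neg_one] at he
    have h1 : -e.2.2 = β e.1 := (h.exists_mem_iff _).1 ⟨j, he⟩
    rw [← h1]
    simp

theorem IsConsistentPartition.eq_of_mem (h : IsConsistentPartition S a β P Q)
    {u v : OrientedEdge m} {e : CopyEdge N m} (hu : e ∈ fineSubstitution Q u)
    (hv : e ∈ fineSubstitution Q v) : u = v := by
  have hs : u.2 = v.2 := mul_right_cancel ((h.sign_eq hu).symm.trans (h.sign_eq hv))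
  obtain ⟨j, ε⟩ := u
  obtain ⟨k, δ⟩ := v
  obtain rfl : ε = δ := hs
  by_contra hne
  have hjk : j ≠ k := fun h => hne (by rw [h])
  rcases Int.units_eq_one_or ε with rfl | rfl
  · rw [mem_fineSubstitution_one] at hu hv
    exact h.disjoint j k hjk hu hv
  · rw [mem_fineSubstitution_neg_one] at hu hv
    exact h.disjoint j k hjk hu hv

/-- One orientation of each copy lies in the unicursal path; the reversed paths supply the other. -/
theorem IsConsistentPartition.exists_mem_fineSubstitution (h : IsConsistentPartition S a β P Q)
    (e : CopyEdge N m) : ∃ u, e ∈ fineSubstitution Q u := by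
  by_cases he : e.2.2 = β e.1
  · obtain ⟨j, hj⟩ := (h.exists_mem_iff e).2 he
    exact ⟨(j, 1), mem_fineSubstitution_one.2 hj⟩
  · have he' : -e.2.2 = β e.1 := by
      rw [← Int.units_ne_iff_eq_neg.1 (Ne.symm he)]
    obtain ⟨j, hj⟩ := (h.exists_mem_iff (e.1, e.2.rev)).2 he'
    exact ⟨(j, -1), mem_fineSubstitution_neg_one.2 hj⟩

theorem IsConsistentPartition.edgeCode_injective (h : IsConsistentPartition S a β P Q) :
    Function.Injective (edgeCode S Q) := by
  rintro ⟨u, k⟩ ⟨v, l⟩ hbc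
  have hu := edgeCode_mem (S := S) (Q := Q) ⟨u, k⟩
  rw [hbc] at hu
  obtain rfl : u = v := h.eq_of_mem hu (edgeCode_mem (S := S) (Q := Q) ⟨v, l⟩)
  exact congrArg (Sigma.mk u) ((h.nodup_fineSubstitution u).get_inj_iff.1 hbc)

/-- Read backwards: the last index and the end state determine the last edge, whose source is the
end state of the remaining path. -/
theorem IsConsistentPartition.path_injective (h : IsConsistentPartition S a β P Q)
    {u : OrientedEdge m} (p q : List (inducedGIFS S Q).Edge)
    (hp : (inducedGIFS S Q).IsPathFrom u p) (hq : (inducedGIFS S Q).IsPathFrom u q)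
    (hend : (inducedGIFS S Q).endState u p = (inducedGIFS S Q).endState u q)
    (hword : p.map (fun b => (edgeCode S Q b).1) = q.map fun b => (edgeCode S Q b).1) :
    p = q := by
  induction p using List.reverseRecOn generalizing q with
  | nil => exact (List.map_eq_nil_iff.1 hword.symm).symm
  | append_singleton p b ih =>
    rcases List.eq_nil_or_concat q with rfl | ⟨q, c, rfl⟩
    · simp at hword
    · rw [List.concat_eq_append] at *
      rw [List.map_append, List.map_append] at hword
      obtain ⟨hw, hbc⟩ := List.append_inj' hword rfl
      rw [GIFS.endState_append, GIFS.endState_append] at hend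
      rw [GIFS.isPathFrom_append] at hp hq
      have hbc' : b = c := h.edgeCode_injective (Prod.ext (by simpa using hbc) hend)
      subst hbc'
      rw [ih q hp.1 hq.1 (hp.2.1.symm.trans hq.2.1) hw]

end Consistent

/-- The state `v` can be reached from the state `u`. -/
def Reaches (S : IFS d N) (Q : Fin m → List (CopyEdge N m)) (u v : OrientedEdge m) : Prop :=
  ∃ p, (inducedGIFS S Q).IsPathFrom u p ∧ (inducedGIFS S Q).endState u p = v

theorem Reaches.trans {u v w : OrientedEdge m} (h : Reaches S Q u v) (h' : Reaches S Q v w) :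
    Reaches S Q u w := by
  obtain ⟨p, hp, rfl⟩ := h
  obtain ⟨q, hq, rfl⟩ := h'
  exact ⟨p ++ q, GIFS.isPathFrom_append.2 ⟨hp, hq⟩, GIFS.endState_append _ _ _⟩

theorem reaches_tgt (b : (inducedGIFS S Q).Edge) :
    Reaches S Q ((inducedGIFS S Q).src b) ((inducedGIFS S Q).tgt b) :=
  ⟨[b], ⟨rfl, trivial⟩, rfl⟩

theorem Reaches.rev {u v : OrientedEdge m} (h : Reaches S Q u v) :
    Reaches S Q u.rev v.rev := by
  obtain ⟨p, hp, rfl⟩ := h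
  induction p generalizing u with
  | nil => exact ⟨[], trivial, rfl⟩
  | cons b p ih =>
    obtain ⟨rfl, hp⟩ := hp
    obtain ⟨b', h1, h2, -⟩ := exists_reverse_edge b
    have h3 := reaches_tgt b'
    rw [h1, h2] at h3
    exact h3.trans (ih hp)

theorem exists_reaches_of_mem_iterate {n : ℕ} {i j : Fin m}
    (h : i ∈ (fun w : List (Fin m) => w.flatMap (coarseSubstitution Q))^[n] [j]) (ε : ℤˣ) :
    ∃ δ, Reaches S Q (j, ε) (i, δ) := by
  induction n generalizing i with
  | zero =>
    obtain rfl : i = j := by simpa using h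
    exact ⟨ε, [], trivial, rfl⟩
  | succ n ih =>
    rw [Function.iterate_succ_apply', List.mem_flatMap] at h
    obtain ⟨k, hk, hi⟩ := h
    obtain ⟨δ, hδ⟩ := ih hk
    obtain ⟨e, he, rfl⟩ := List.mem_map.1 hi
    have hedge : ∃ γ, Reaches S Q (k, δ) (e.2.1, γ) := by
      rcases Int.units_eq_one_or δ with rfl | rfl
      · obtain ⟨b, hb, hbe⟩ := exists_edgeCode_eq (S := S) (mem_fineSubstitution_one.2 he)
        have := reaches_tgt b
        rw [hb, inducedGIFS_tgt, hbe] at this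
        exact ⟨_, this⟩
      · obtain ⟨b, hb, hbe⟩ := exists_edgeCode_eq (S := S) (Q := Q) (u := (k, -1))
          (e := (e.1, e.2.rev)) (mem_fineSubstitution_neg_one.2 (by simpa using he))
        have := reaches_tgt b
        rw [hb, inducedGIFS_tgt, hbe] at this
        exact ⟨_, this⟩
    obtain ⟨γ, hγ⟩ := hedge
    exact ⟨γ, hδ.trans hγ⟩

/-- The coarse substitution forgets orientations, so the sign of the state reached is not
controlled. -/
theorem IsPrimitivePartition.reaches_or (h : IsPrimitivePartition Q) (u v : OrientedEdge m) :
    Reaches S Q u v ∨ Reaches S Q u v.rev := by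
  obtain ⟨n, -, hn⟩ := h
  obtain ⟨δ, hδ⟩ := exists_reaches_of_mem_iterate (S := S) (hn v.1 u.1) u.2
  by_cases hv : δ = v.2
  · left
    rwa [hv] at hδ
  · right
    rwa [Int.units_ne_iff_eq_neg.1 hv] at hδ

/-- If `v` reaches only `u⁻¹`, reversing both known paths gives `v → u⁻¹ → v⁻¹ → u`. The whole graph
need not be strongly connected. -/
theorem IsPrimitivePartition.reaches_symm (h : IsPrimitivePartition Q) {u v : OrientedEdge m}
    (huv : Reaches S Q u v) : Reaches S Q v u := by
  rcases h.reaches_or (S := S) v u with h1 | h1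
  · exact h1
  · have h2 := huv.rev.trans h1.rev
    rw [OrientedEdge.rev_rev] at h2
    exact h1.trans h2

/-! ### Invariant sets of the induced GIFS -/

section Invariant

variable {E : OrientedEdge m → Set (EuclideanSpace ℝ (Fin d))} {K : Set (EuclideanSpace ℝ (Fin d))}

theorem subset_invariantSet (hE : (inducedGIFS S Q).IsInvariantFamily E)
    (hK : S.IsInvariantSet K) (u : OrientedEdge m) : E u ⊆ K := by
  obtain ⟨c, hc0, hc1, hc⟩ := exists_ratio_le_lt_one S
  refine subset_of_contraction (E' := fun _ => K) (fun u => (hE.1 u).2.isBounded)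
    (fun _ => hK.2.1.isClosed) (fun _ => hK.1) hc0 hc1 (fun u x hx => ?_) u
  obtain ⟨b, -, y, hy, rfl⟩ := hE.exists_edge hx
  exact ⟨_, _, hc _, ⟨y, hy, rfl⟩, hK.map_mem _⟩

/-- By the reversal symmetry, each edge leaving `u` has a partner leaving `u.rev` with the same map.
Applied to `u.rev` as well, this gives equality. -/
theorem subset_rev (hE : (inducedGIFS S Q).IsInvariantFamily E) (u : OrientedEdge m) :
    E u ⊆ E u.rev := by
  obtain ⟨c, hc0, hc1, hc⟩ := exists_ratio_le_lt_one S
  refine subset_of_contraction (E' := fun u => E u.rev) (fun u => (hE.1 u).2.isBounded)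
    (fun u => (hE.1 u.rev).2.isClosed) (fun u => (hE.1 u.rev).1) hc0 hc1 (fun u x hx => ?_) u
  obtain ⟨b, rfl, y, hy, rfl⟩ := hE.exists_edge hx
  obtain ⟨b', h1, h2, h3⟩ := exists_reverse_edge b
  refine ⟨_, _, hc _, ⟨y, hy, rfl⟩, fun z hz => ?_⟩
  have hmem := hE.map_mem b' (h2 ▸ hz)
  rw [h1, h3] at hmem
  exact hmem

/-- Every pair `(i, v)` labels an edge, so each `S_i` maps the union of the `E_u` into itself; a
closed nonempty set with this property contains `K`. -/
theorem invariantSet_subset_iUnion [NeZero m] {a : Fin m → EuclideanSpace ℝ (Fin d)}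
    {β : Fin N → ℤˣ} {P : List (CopyEdge N m)} (h : IsConsistentPartition S a β P Q)
    (hE : (inducedGIFS S Q).IsInvariantFamily E) (hK : S.IsInvariantSet K) : K ⊆ ⋃ u, E u := by
  obtain ⟨c, hc0, hc1, hc⟩ := exists_ratio_le_lt_one S
  refine subset_of_contraction (V := Unit) (E := fun _ => K) (E' := fun _ => ⋃ u, E u)
    (fun _ => hK.2.1.isBounded) (fun _ => isClosed_iUnion_of_finite fun u => (hE.1 u).2.isClosed)
    (fun _ => nonempty_iUnion.2 ⟨(0, 1), (hE.1 _).1⟩) hc0 hc1 (fun _ x hx => ?_) ()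
  rw [hK.2.2] at hx
  obtain ⟨i, y, hy, rfl⟩ := mem_iUnion.1 hx
  refine ⟨(), S i, hc i, ⟨y, hy, rfl⟩, fun z hz => ?_⟩
  obtain ⟨v, hv⟩ := mem_iUnion.1 hz
  obtain ⟨u, hu⟩ := h.exists_mem_fineSubstitution (i, v)
  obtain ⟨b, -, hb⟩ := exists_edgeCode_eq (S := S) hu
  have hmem := hE.map_mem b (x := z) (by rw [inducedGIFS_tgt, hb]; exact hv)
  rw [inducedGIFS_map, Function.comp_apply, hb] at hmem
  exact mem_iUnion.2 ⟨_, hmem⟩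

theorem induced_openSetCondition [NeZero m] {a : Fin m → EuclideanSpace ℝ (Fin d)}
    {β : Fin N → ℤˣ} {P : List (CopyEdge N m)} (h : IsConsistentPartition S a β P Q)
    (hprim : IsPrimitivePartition Q) (hS : S.OpenSetCondition) (hK : S.IsInvariantSet K)
    (hE : (inducedGIFS S Q).IsInvariantFamily E) : (inducedGIFS S Q).OpenSetCondition := by
  classical
  obtain ⟨C, hC⟩ := hS.exists_card_le hK.2.1.isBounded
  -- Among the paths with a given end state, the index word is injective and is a cut word of the
  -- IFS, so there are at most `C` of them; then sum over the end states.
  refine hE.openSetCondition (fun b => hprim.reaches_symm (reaches_tgt b))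
    (C := C * Fintype.card (OrientedEdge m)) fun u r hr hr1 X W hW => ?_
  refine Finset.card_le_mul_card_image_of_maps_to (f := (inducedGIFS S Q).endState u)
    (fun _ _ => Finset.mem_univ _) C fun v _ => ?_
  rw [← Finset.card_image_of_injOn (f := List.map fun b => (edgeCode S Q b).1)]
  · refine hC r hr hr1 X _ fun w hw => ?_
    obtain ⟨p, hp, rfl⟩ := Finset.mem_image.1 hw
    obtain ⟨-, hcut, y, hy, hyX⟩ := hW p (Finset.mem_filter.1 hp).1
    refine ⟨IsCutWord.of_map hcut, y, subset_invariantSet hE hK _ hy, ?_⟩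
    rw [wordMap_map]
    exact hyX
  · intro p hp q hq hpq
    obtain ⟨hp, hpv⟩ := Finset.mem_filter.1 hp
    obtain ⟨hq, hqv⟩ := Finset.mem_filter.1 hq
    exact h.path_injective p q (hW p hp).1 (hW q hq).1 (hpv.trans hqv.symm) hpq

theorem hausdorffMeasure_pos_of_reaches {s : ℝ} (hs : 0 ≤ s)
    (hE : (inducedGIFS S Q).IsInvariantFamily E) {u v : OrientedEdge m} (huv : Reaches S Q u v)
    (hv : 0 < μH[s] (E v)) : 0 < μH[s] (E u) := by
  obtain ⟨p, hp, rfl⟩ := huv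
  have hanti : AntilipschitzWith (wordRatio (inducedGIFS S Q).map p)⁻¹.toNNReal
      (wordMap (inducedGIFS S Q).map p) := by
    have hr := wordRatio_pos (inducedGIFS S Q).map p
    refine AntilipschitzWith.of_le_mul_dist fun x y => ?_
    rw [dist_wordMap, Real.coe_toNNReal _ (inv_nonneg.2 hr.le), inv_mul_cancel_left₀ hr.ne']
  have h1 := hanti.le_hausdorffMeasure_image hs (E ((inducedGIFS S Q).endState u p))
  have h2 : wordMap (inducedGIFS S Q).map p '' E ((inducedGIFS S Q).endState u p) ⊆ E u := by
    rintro _ ⟨x, hx, rfl⟩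
    exact hE.wordMap_mem hp hx
  refine pos_iff_ne_zero.2 fun h0 => ?_
  rw [measure_mono_null h2 h0, mul_zero] at h1
  exact absurd hv h1.not_gt

end Invariant

end InducedGIFS

end SpaceFilling

theorem mainTheorem2 {d N m : ℕ} [NeZero m]
    (S : IFS d N) (K : Set (EuclideanSpace ℝ (Fin d))) (hK : S.IsInvariantSet K)
    (hOSC : S.OpenSetCondition)
    (a : Fin m → EuclideanSpace ℝ (Fin d)) (ha : Function.Injective a)
    (hA : S.IsSkeleton K (Set.range a))
    (β : Fin N → ℤˣ) (P : List (CopyEdge N m)) (Q : Fin m → List (CopyEdge N m))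
    (hcons : IsConsistentPartition S a β P Q)
    (hprim : IsPrimitivePartition Q)
    (E : OrientedEdge m → Set (EuclideanSpace ℝ (Fin d)))
    (hE : (inducedGIFS S Q).IsInvariantFamily E) :
    (inducedGIFS S Q).OpenSetCondition ∧
      ∃ s : ℝ≥0, (s : ENNReal) = dimH K ∧
        ∀ v, 0 < μH[(s : ℝ)] (E v) ∧ μH[(s : ℝ)] (E v) < ⊤ := by
  refine ⟨induced_openSetCondition hcons hprim hOSC hK hE, ?_⟩
  have hN : NeZero N := ⟨by
    rintro rfl
    have h := hK.1
    rw [hK.2.2] at h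
    obtain ⟨x, hx⟩ := h
    exact (mem_iUnion.1 hx).choose.elim0⟩
  obtain ⟨s, hs⟩ := S.exists_similarity_dimension
  have hpos := hK.hausdorffMeasure_pos hOSC s.2 hs
  have htop := hK.hausdorffMeasure_lt_top s.2 hs
  refine ⟨s, (dimH_of_hausdorffMeasure_ne_zero_ne_top hpos.ne' htop.ne).symm, fun u =>
    ⟨?_, (measure_mono (subset_invariantSet hE hK u)).trans_lt htop⟩⟩
  -- Otherwise `K` would lie in a finite union of null sets.
  obtain ⟨v, hv⟩ : ∃ v, 0 < μH[(s : ℝ)] (E v) := by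
    by_contra! h
    have h0 := measure_iUnion_null fun v => nonpos_iff_eq_zero.1 (h v)
    exact hpos.ne' (measure_mono_null (invariantSet_subset_iUnion hcons hE hK) h0)
  rcases hprim.reaches_or (S := S) u v with h | h
  · exact hausdorffMeasure_pos_of_reaches s.2 hE h hv
  · exact hausdorffMeasure_pos_of_reaches s.2 hE h (hv.trans_le (measure_mono (subset_rev hE v)))
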